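/- Let $k$ be a field, let $q\in k$ be a primitive $\ell$-th root of unity with $\ell\ge 1$, and let $n\ge 0$. Let $A_q(n)$ be the $k$-algebra generated by $c_{ij}$ ($1\le i,j\le n$) subject to $$c_{ir}c_{is}=c_{is}c_{ir}\ \ (\text{all } i,r,s),\qquad c_{jr}c_{is}=q\,c_{is}c_{jr}\ \ (i<j,\ r\le s),$$ $$c_{js}c_{ir}=c_{ir}c_{js}+(q-1)c_{is}c_{jr}\ \ (i<j,\ r<s).$$ Let $d_q=\sum_{\sigma\in S_n}\operatorname{sgn}(\sigma)\,c_{1,\sigma(1)}c_{2,\sigma(2)}\cdots c_{n,\sigma(n)}$ be the quantum determinant, and let $k[G]=A_q(n)_{d_q}$ be the localisation of $A_q(n)$ at $d_q$, the coordinate algebra of the (Dipper–Donkin) quantum general linear group $G$, with comultiplication $c_{ij}\mapsto\sum_r c_{ir}\otimes c_{rj}$ and counit $c_{ij}\mapsto\delta_{ij}$. Let $k[\overline G]=k[y_{ij}]_{\det(y_{ij})}$ be the coordinate algebra of the classical group $\overline G=GL_n$ over $k$, and let $\widetilde F:k[\overline G]\to k[G]$ be the comorphism of the quantum Frobenius morphism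 $F:G\to\overline G$, that is, the bialgebra homomorphism with $\widetilde F(y_{ij})=c_{ij}^{\ell}$. Modules for $G$ (for $\overline G$) are right comodules over $k[G]$ (over $k[\overline G]$). The structure map of a tensor product of two $G$-modules is $v\otimes w\mapsto\sum v_{(0)}\otimes w_{(0)}\otimes v_{(1)}w_{(1)}$. For a $\overline G$-module $N$ with structure map $\psi_N$, the $G$-module $N^F$ is the vector space $N$ with structure map $(\mathrm{id}\otimes\widetilde F)\circ\psi_N$. Then the image of $\widetilde F$ is contained in the centre of $k[G]$. Moreover, for every finite-dimensional $G$-module $M$ and every $\overline G$-module $N$, the flip map $x\otimes y\mapsto y\otimes x$ is an isomorphism of $G$-modules $$M\otimes N^F\;\cong\;N^F\otimes M .$$ -/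

import Mathlib

open scoped TensorProduct

/-! ## Quantum matrices and the quantum determinant -/

/-- A square matrix `X` with entries in a `k`-algebra `R` is a quantum matrix (with parameter `q`,
in the sense of Dipper and Donkin) if its entries satisfy the defining relations of the
coordinate algebra of quantum `n × n` matrices. -/
structure IsQuantumMatrix {k R : Type*} [CommRing k] [Ring R] [Algebra k R] {n : ℕ} (q : k)
    (X : Matrix (Fin n) (Fin n) R) : Prop where
  row : ∀ i r s, X i r * X i s = X i s * X i r
  col : ∀ i j r s, i < j → r ≤ s → X j r * X i s = q • (X i s * X j r)
  cross : ∀ i j r s, i < j → r < s →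
    X j s * X i r = X i r * X j s + (q - 1) • (X i s * X j r)

/-- The quantum determinant `∑_σ sgn(σ) X_{1,σ(1)} X_{2,σ(2)} ⋯ X_{n,σ(n)}`, the factors being
multiplied in this order. -/
def qdet {R : Type*} [Ring R] {n : ℕ} (X : Matrix (Fin n) (Fin n) R) : R :=
  ∑ σ : Equiv.Perm (Fin n), Equiv.Perm.sign σ • (List.ofFn fun i => X i (σ i)).prod

section QuantumMatrix

variable {k R : Type*} [CommRing k] [Ring R] [Algebra k R] {n : ℕ} {q : k}
  {X Y : Matrix (Fin n) (Fin n) R}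

theorem IsQuantumMatrix.symm_cols (hX : IsQuantumMatrix q X) (i j r s : Fin n) :
    X i r * X j s + X j r * X i s = X i s * X j r + X j s * X i r := by
  have key : ∀ i j r s : Fin n, i < j → r < s →
      X i r * X j s + X j r * X i s = X i s * X j r + X j s * X i r := by
    intro i j r s hij hrs
    rw [hX.cross i j r s hij hrs, hX.col i j r s hij hrs.le, sub_smul, one_smul]
    abel
  rcases lt_trichotomy i j with h | h | h
  · rcases lt_trichotomy r s with h' | h' | h'
    · exact key i j r s h h'
    · subst h'; rfl
    · exact (key i j s r h h').symm
  · subst h; rw [hX.row i r s]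
  · rcases lt_trichotomy r s with h' | h' | h'
    · rw [add_comm, key j i r s h h', add_comm]
    · subst h'; rfl
    · rw [add_comm, ← key j i s r h h', add_comm]

theorem sum_sum_eq_of_pairs {M : Type*} [AddCommMonoid M] (f g : Fin n → Fin n → M)
    (h0 : ∀ a, f a a = g a a) (h1 : ∀ a b, a < b → f a b + f b a = g a b + g b a) :
    ∑ a, ∑ b, f a b = ∑ a, ∑ b, g a b := by
  have key : ∀ f : Fin n → Fin n → M, ∑ a, ∑ b, f a b =
      ∑ a, f a a + ∑ a, ∑ b, if a < b then f a b + f b a else 0 := by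
    intro f
    have e1 : ∀ a b, f a b = (if a = b then f a b else 0) + ((if a < b then f a b else 0) +
        (if b < a then f a b else 0)) := by
      intro a b
      rcases lt_trichotomy a b with h | h | h
      · simp [h, h.ne, h.not_gt]
      · simp [h]
      · simp [h, h.ne', h.not_gt]
    have e2 : ∀ a b, (if a < b then f a b + f b a else 0) =
        (if a < b then f a b else 0) + (if a < b then f b a else 0) := by
      intro a b; split_ifs <;> simp
    simp_rw [e2, Finset.sum_add_distrib]
    rw [Finset.sum_comm (f := fun a b => if a < b then f b a else 0)]
    simp_rw [← Finset.sum_add_distrib]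
    refine Finset.sum_congr rfl fun a _ => ?_
    conv_lhs => enter [2, b]; rw [e1 a b]
    simp [Finset.sum_add_distrib]
  rw [key f, key g]
  simp_rw [h0]
  congr 1
  refine Finset.sum_congr rfl fun a _ => Finset.sum_congr rfl fun b _ => ?_
  split_ifs with h
  · exact h1 a b h
  · rfl

theorem IsQuantumMatrix.mul (hX : IsQuantumMatrix q X) (hY : IsQuantumMatrix q Y)
    (hXY : ∀ i j r s, Commute (X i j) (Y r s)) : IsQuantumMatrix q (X * Y) := by
  have hc : ∀ i j r s, Y r s * X i j = X i j * Y r s := fun i j r s => ((hXY i j r s).eq).symm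
  have expand : ∀ i r j s, (X * Y) i r * (X * Y) j s =
      ∑ a, ∑ b, (X i a * X j b) * (Y a r * Y b s) := by
    intro i r j s
    rw [Matrix.mul_apply, Matrix.mul_apply, Finset.sum_mul_sum]
    refine Finset.sum_congr rfl fun a _ => Finset.sum_congr rfl fun b _ => ?_
    rw [mul_assoc, ← mul_assoc (Y a r), hc]; simp only [mul_assoc]
  constructor
  · intro i r s
    rw [expand, expand]
    refine sum_sum_eq_of_pairs _ _ (fun a => by rw [hY.row a r s]) fun a b _ => ?_
    rw [hX.row i b a, ← mul_add, ← mul_add, hY.symm_cols]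
  · intro i j r s hij hrs
    rw [expand, expand, Finset.smul_sum]
    simp_rw [Finset.smul_sum]
    refine sum_sum_eq_of_pairs _ _ (fun a => ?_) fun a b hab => ?_
    · rw [hX.col i j a a hij le_rfl, hY.row a r s, smul_mul_assoc]
    · rw [hX.col i j a b hij hab.le, hX.cross i j a b hij hab, hY.col a b r s hab hrs]
      rcases hrs.lt_or_eq with h | h
      · rw [hY.cross a b r s hab h]
        simp only [add_mul, mul_add, smul_mul_assoc, mul_smul_comm, smul_add, smul_smul]
        module
      · subst h
        rw [hY.col a b r r hab le_rfl]
        simp only [add_mul, smul_mul_assoc, mul_smul_comm, smul_add, smul_smul]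
        module
  · intro i j r s hij hrs
    rw [expand, expand, expand, Finset.smul_sum]
    simp_rw [Finset.smul_sum, ← Finset.sum_add_distrib]
    refine sum_sum_eq_of_pairs _ _ (fun a => ?_) fun a b hab => ?_
    · rw [hX.col i j a a hij le_rfl, hY.row a r s, smul_mul_assoc, sub_smul, one_smul]
      abel
    · rw [hX.col i j a b hij hab.le, hX.cross i j a b hij hab, hY.col a b r s hab hrs.le,
        hY.cross a b r s hab hrs]
      simp only [add_mul, mul_add, smul_mul_assoc, mul_smul_comm, smul_add, smul_smul]
      module

/-- The quantum determinant formed with the rows `f 0, f 1, …` of `X`. -/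
def qdetRows (X : Matrix (Fin n) (Fin n) R) (f : Fin n → Fin n) : R :=
  qdet (X.submatrix f id)

theorem exists_prod_ofFn_eq {m : ℕ} (p : Fin m) :
    ∃ L T : (Fin (m + 1) → R) → R,
      (∀ h, (List.ofFn h).prod = L h * (h p.castSucc * h p.succ) * T h) ∧
      (∀ h h' : Fin (m + 1) → R, (∀ i, i ≠ p.castSucc → i ≠ p.succ → h i = h' i) →
        L h = L h' ∧ T h = T h') := by
  refine ⟨fun h => ((List.ofFn h).take p).prod, fun h => ((List.ofFn h).drop (p + 2)).prod,
    fun h => ?_, fun h h' hh => ⟨?_, ?_⟩⟩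
  · have hp := p.2
    conv_lhs => rw [← List.take_append_drop p (List.ofFn h), List.prod_append,
      List.drop_eq_getElem_cons (by simp), List.prod_cons,
      List.drop_eq_getElem_cons (by simp), List.prod_cons]
    simp only [List.getElem_ofFn, mul_assoc]
    rfl
  · refine congrArg List.prod (List.ext_getElem (by simp) fun i h1 h2 => ?_)
    simp only [List.length_take, List.length_ofFn] at h1
    simp only [List.getElem_take, List.getElem_ofFn]
    refine hh _ ?_ ?_ <;> simp only [ne_eq, Fin.ext_iff, Fin.val_castSucc, Fin.val_succ] <;> omega
  · refine congrArg List.prod (List.ext_getElem (by simp) fun i h1 h2 => ?_)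
    simp only [List.getElem_drop, List.getElem_ofFn]
    refine hh _ ?_ ?_ <;> simp only [ne_eq, Fin.ext_iff, Fin.val_castSucc, Fin.val_succ] <;> omega

theorem sum_perm_eq_zero (g : Equiv.Perm (Fin n) → R) (τ : Equiv.Perm (Fin n)) (hτ : τ ≠ 1)
    (hτ2 : τ * τ = 1) (hg : ∀ σ, g σ + g (σ * τ) = 0) : ∑ σ, g σ = 0 := by
  refine Finset.sum_involution (fun σ _ => σ * τ) (fun σ _ => hg σ) (fun σ _ _ h => hτ ?_)
    (fun _ _ => Finset.mem_univ _) (fun σ _ => ?_)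
  · simpa using h
  · rw [mul_assoc, hτ2, mul_one]

theorem IsQuantumMatrix.qdetRows_adj {m : ℕ} {X : Matrix (Fin (m + 1)) (Fin (m + 1)) R}
    (hX : IsQuantumMatrix q X) (p : Fin m) (f : Fin (m + 1) → Fin (m + 1)) :
    qdetRows X (f ∘ Equiv.swap p.castSucc p.succ) = - qdetRows X f := by
  obtain ⟨L, T, hLT, hext⟩ := exists_prod_ofFn_eq (R := R) p
  set τ := Equiv.swap p.castSucc p.succ with hτ
  have hne : p.castSucc ≠ p.succ := Fin.castSucc_lt_succ.ne
  have t1 : τ p.castSucc = p.succ := Equiv.swap_apply_left _ _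
  have t2 : τ p.succ = p.castSucc := Equiv.swap_apply_right _ _
  have t3 : ∀ i, i ≠ p.castSucc → i ≠ p.succ → τ i = i :=
    fun i h1 h2 => Equiv.swap_apply_of_ne_of_ne h1 h2
  rw [← add_eq_zero_iff_eq_neg]
  unfold qdetRows qdet
  rw [← Finset.sum_add_distrib]
  refine sum_perm_eq_zero _ τ (fun h => hne ?_) (Equiv.swap_mul_self _ _) fun σ => ?_
  · have := t1; rw [h] at this; simpa using this
  · have hs : Equiv.Perm.sign (σ * τ) = - Equiv.Perm.sign σ := by
      rw [Equiv.Perm.sign_mul, hτ, Equiv.Perm.sign_swap hne, mul_neg_one]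
    simp only [hs, hLT, Matrix.submatrix_apply, id, Function.comp, Equiv.Perm.mul_apply, t1, t2]
    set h0 : Fin (m + 1) → R := fun i => X (f i) (σ i)
    have a1 := hext (fun i => X (f (τ i)) (σ i)) h0 (fun i h1 h2 => by simp [h0, t3 i h1 h2])
    have a2 := hext (fun i => X (f (τ i)) (σ (τ i))) h0 (fun i h1 h2 => by simp [h0, t3 i h1 h2])
    have a3 := hext (fun i => X (f i) (σ (τ i))) h0 (fun i h1 h2 => by simp [h0, t3 i h1 h2])
    rw [a1.1, a1.2, a2.1, a2.2, a3.1, a3.2, Units.neg_smul, Units.neg_smul, ← neg_add,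
      ← sub_eq_add_neg, ← smul_add, ← smul_add, ← smul_sub]
    have e := congrArg (fun z => L h0 * z * T h0)
      (hX.symm_cols (f p.castSucc) (f p.succ) (σ p.castSucc) (σ p.succ))
    simp only [mul_add, add_mul] at e
    rw [sub_eq_zero_of_eq, smul_zero]
    rw [add_comm, e]
    exact add_comm _ _

theorem IsQuantumMatrix.qdetRows_adj_zero {m : ℕ} {X : Matrix (Fin (m + 1)) (Fin (m + 1)) R}
    (hX : IsQuantumMatrix q X) (p : Fin m) (f : Fin (m + 1) → Fin (m + 1))
    (hf : f p.castSucc = f p.succ) : qdetRows X f = 0 := by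
  obtain ⟨L, T, hLT, hext⟩ := exists_prod_ofFn_eq (R := R) p
  set τ := Equiv.swap p.castSucc p.succ with hτ
  have hne : p.castSucc ≠ p.succ := Fin.castSucc_lt_succ.ne
  have t1 : τ p.castSucc = p.succ := Equiv.swap_apply_left _ _
  have t2 : τ p.succ = p.castSucc := Equiv.swap_apply_right _ _
  have t3 : ∀ i, i ≠ p.castSucc → i ≠ p.succ → τ i = i :=
    fun i h1 h2 => Equiv.swap_apply_of_ne_of_ne h1 h2
  refine sum_perm_eq_zero _ τ (fun h => hne ?_) (Equiv.swap_mul_self _ _) fun σ => ?_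
  · have := t1; rw [h] at this; simpa using this
  · have hs : Equiv.Perm.sign (σ * τ) = - Equiv.Perm.sign σ := by
      rw [Equiv.Perm.sign_mul, hτ, Equiv.Perm.sign_swap hne, mul_neg_one]
    simp only [hs, hLT, Matrix.submatrix_apply, id, Equiv.Perm.mul_apply, t1, t2]
    set h0 : Fin (m + 1) → R := fun i => X (f i) (σ i)
    have a3 := hext (fun i => X (f i) (σ (τ i))) h0 (fun i h1 h2 => by simp [h0, t3 i h1 h2])
    rw [a3.1, a3.2, Units.neg_smul, hf, hX.row _ (σ p.castSucc), add_neg_cancel]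

theorem IsQuantumMatrix.qdetRows_comp (hX : IsQuantumMatrix q X) (τ : Equiv.Perm (Fin n))
    (f : Fin n → Fin n) : qdetRows X (f ∘ τ) = Equiv.Perm.sign τ • qdetRows X f := by
  cases n with
  | zero => rw [Subsingleton.elim τ 1, Equiv.Perm.sign_one, one_smul]; rfl
  | succ m =>
    have hτ : τ ∈ Submonoid.closure
        (Set.range fun i : Fin m => Equiv.swap i.castSucc i.succ) := by
      rw [Equiv.Perm.mclosure_swap_castSucc_succ]; trivial
    induction hτ using Submonoid.closure_induction generalizing f with
    | mem x hx =>
      obtain ⟨p, rfl⟩ := hx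
      rw [hX.qdetRows_adj, Equiv.Perm.sign_swap Fin.castSucc_lt_succ.ne, Units.neg_smul, one_smul]
    | one => rw [Equiv.Perm.sign_one, one_smul]; rfl
    | mul x y _ _ hx hy =>
      rw [Equiv.Perm.coe_mul, ← Function.comp_assoc, hy, hx, smul_smul, Equiv.Perm.sign_mul,
        mul_comm]

theorem IsQuantumMatrix.qdetRows_eq_zero (hX : IsQuantumMatrix q X) (f : Fin n → Fin n)
    (hf : ¬ Function.Injective f) : qdetRows X f = 0 := by
  have key : ∀ a b : Fin n, a < b → f a = f b → qdetRows X f = 0 := by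
    intro a b hab hfab
    cases n with
    | zero => exact a.elim0
    | succ m =>
      obtain ⟨p, rfl⟩ : ∃ p : Fin m, p.castSucc = a :=
        ⟨⟨a, by have := b.2; have : a.1 < b.1 := hab; omega⟩, rfl⟩
      set τ := Equiv.swap p.succ b with hτ
      have h0 : qdetRows X (f ∘ τ) = 0 := by
        refine hX.qdetRows_adj_zero p _ ?_
        simp only [Function.comp, hτ, Equiv.swap_apply_left]
        rw [Equiv.swap_apply_of_ne_of_ne Fin.castSucc_lt_succ.ne hab.ne, hfab]
      rw [hX.qdetRows_comp, smul_eq_zero_iff_eq] at h0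
      exact h0
  simp only [Function.Injective, not_forall] at hf
  obtain ⟨a, b, hfab, hne⟩ := hf
  rcases lt_or_gt_of_ne hne with h | h
  · exact key a b h hfab
  · exact key b a h hfab.symm

theorem qdetRows_id (X : Matrix (Fin n) (Fin n) R) : qdetRows X id = qdet X := rfl

theorem prod_ofFn_sum {ι : Type*} [Fintype ι] [DecidableEq ι] : ∀ {m : ℕ} (g : Fin m → ι → R),
    (List.ofFn fun i => ∑ a, g i a).prod = ∑ f : Fin m → ι, (List.ofFn fun i => g i (f i)).prod
  | 0, g => by simp
  | m + 1, g => by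
    rw [List.ofFn_succ, List.prod_cons, prod_ofFn_sum (fun i => g i.succ), Finset.sum_mul_sum,
      ← (Fin.consEquiv fun _ : Fin (m + 1) => ι).sum_comp, Fintype.sum_prod_type]
    simp [List.ofFn_succ, Fin.consEquiv]

theorem prod_ofFn_mul_of_commute : ∀ {m : ℕ} (g h : Fin m → R)
    (_ : ∀ i j, Commute (g i) (h j)),
    (List.ofFn fun i => g i * h i).prod = (List.ofFn g).prod * (List.ofFn h).prod
  | 0, g, h, _ => by simp
  | m + 1, g, h, hgh => by
    rw [List.ofFn_succ, List.prod_cons, prod_ofFn_mul_of_commute (fun i => g i.succ)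
      (fun i => h i.succ) (fun i j => hgh _ _), List.ofFn_succ, List.ofFn_succ, List.prod_cons,
      List.prod_cons]
    have : Commute (List.ofFn fun i => g i.succ).prod (h 0) :=
      Commute.list_prod_left _ _ fun x hx => by
        obtain ⟨i, rfl⟩ := (List.mem_ofFn' _ _).1 hx
        exact hgh _ _
    simp only [mul_assoc]
    rw [← mul_assoc (h 0), ← this.eq]; simp only [mul_assoc]

theorem IsQuantumMatrix.qdet_mul (hY : IsQuantumMatrix q Y)
    (hXY : ∀ i j r s, Commute (X i j) (Y r s)) : qdet (X * Y) = qdet X * qdet Y := by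
  have e1 : qdet (X * Y) =
      ∑ f : Fin n → Fin n, (List.ofFn fun i => X i (f i)).prod * qdetRows Y f := by
    unfold qdetRows
    simp only [qdet, Matrix.mul_apply, prod_ofFn_sum, Finset.mul_sum, Finset.smul_sum,
      Matrix.submatrix_apply, id]
    rw [Finset.sum_comm]
    refine Finset.sum_congr rfl fun f _ => Finset.sum_congr rfl fun σ _ => ?_
    rw [prod_ofFn_mul_of_commute _ _ fun i j => hXY _ _ _ _, mul_smul_comm]
  have e2 : qdet X = ∑ σ : Equiv.Perm (Fin n), Equiv.Perm.sign σ •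
    (List.ofFn fun i => X i (σ i)).prod := rfl
  rw [e1, e2, Finset.sum_mul]
  symm
  refine Finset.sum_of_injOn (fun σ : Equiv.Perm (Fin n) => (σ : Fin n → Fin n))
    (fun _ _ _ _ h => DFunLike.coe_injective h) (fun _ _ => Finset.mem_coe.2 (Finset.mem_univ _))
    (fun f _ hf => ?_) fun σ _ => ?_
  · rw [hY.qdetRows_eq_zero f, mul_zero]
    intro hinj
    exact hf ⟨Equiv.ofBijective f (Finite.injective_iff_bijective.1 hinj),
      Finset.mem_coe.2 (Finset.mem_univ _), rfl⟩
  · have := hY.qdetRows_comp σ id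
    rw [Function.id_comp] at this
    rw [this, qdetRows_id, smul_mul_assoc, mul_smul_comm]

end QuantumMatrix

/-! ## Powers of the entries of a quantum matrix at a root of unity -/

section QBinomial

/-- The Gaussian binomial coefficients. -/
def gaussBinom {k : Type*} [CommRing k] (q : k) : ℕ → ℕ → k
  | _, 0 => 1
  | 0, _ + 1 => 0
  | m + 1, i + 1 => gaussBinom q m i + q ^ (i + 1) * gaussBinom q m (i + 1)

variable {k R : Type*} [CommRing k] [Ring R] [Algebra k R] {q : k}

theorem gaussBinom_eq_zero (q : k) : ∀ {m i : ℕ}, m < i → gaussBinom q m i = 0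
  | 0, _ + 1, _ => by rw [gaussBinom]
  | m + 1, i + 1, h => by
    rw [gaussBinom, gaussBinom_eq_zero q (by omega), gaussBinom_eq_zero q (by omega)]; simp

theorem gaussBinom_zero_right (q : k) (m : ℕ) : gaussBinom q m 0 = 1 := by
  cases m <;> rw [gaussBinom]

theorem gaussBinom_self (q : k) : ∀ m : ℕ, gaussBinom q m m = 1
  | 0 => by rw [gaussBinom]
  | m + 1 => by rw [gaussBinom, gaussBinom_self q m, gaussBinom_eq_zero q (by omega)]; simp

theorem gaussBinom_mul (q : k) : ∀ m i : ℕ,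
    gaussBinom q (m + 1) (i + 1) * (1 - q ^ (i + 1)) = (1 - q ^ (m + 1)) * gaussBinom q m i
  | 0, 0 => by simp [gaussBinom]
  | 0, i + 1 => by simp [gaussBinom]
  | m + 1, 0 => by
    have h1 := gaussBinom_mul q m 0
    have h3 : gaussBinom q (m + 2) 1 =
      gaussBinom q (m + 1) 0 + q ^ 1 * gaussBinom q (m + 1) 1 := rfl
    simp only [gaussBinom_zero_right, zero_add] at *
    rw [h3]
    linear_combination q * h1
  | m + 1, i + 1 => by
    have h1 := gaussBinom_mul q m (i + 1)
    have h2 := gaussBinom_mul q m i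
    have h3 : gaussBinom q (m + 1) (i + 1) =
      gaussBinom q m i + q ^ (i + 1) * gaussBinom q m (i + 1) := by rw [gaussBinom]
    have h4 : gaussBinom q (m + 2) (i + 2) =
      gaussBinom q (m + 1) (i + 1) + q ^ (i + 2) * gaussBinom q (m + 1) (i + 2) := by
      rw [gaussBinom]
    rw [h4]
    linear_combination q ^ (i + 2) * h1 + q * h2 - q * (1 - q ^ (m + 1)) * h3

theorem qcomm_pow {x y : R} (h : y * x = q • (x * y)) (i : ℕ) :
    y * x ^ i = q ^ i • (x ^ i * y) := by
  induction i with
  | zero => simp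
  | succ i ih =>
    rw [pow_succ, ← mul_assoc, ih, smul_mul_assoc, mul_assoc, h, mul_smul_comm, smul_smul,
      mul_assoc, pow_succ]

theorem qcomm_add_pow {x y : R} (h : y * x = q • (x * y)) (m : ℕ) :
    (x + y) ^ m = ∑ i ∈ Finset.range (m + 1), gaussBinom q m i • (x ^ i * y ^ (m - i)) := by
  induction m with
  | zero => simp [gaussBinom]
  | succ m ih =>
    have e1 : ∀ i ∈ Finset.range (m + 1), y * (gaussBinom q m i • (x ^ i * y ^ (m - i))) =
        (q ^ i * gaussBinom q m i) • (x ^ i * y ^ (m + 1 - i)) := by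
      intro i hi
      have : m + 1 - i = (m - i) + 1 := by have := Finset.mem_range.1 hi; omega
      rw [mul_smul_comm, ← mul_assoc, qcomm_pow h, smul_mul_assoc, smul_smul, mul_assoc,
        ← pow_succ', this, mul_comm (q ^ i)]
    rw [pow_succ', ih, add_mul, Finset.mul_sum, Finset.mul_sum, Finset.sum_congr rfl e1,
      Finset.sum_range_succ' _ (m + 1)]
    have e2 : ∑ i ∈ Finset.range (m + 1), (q ^ i * gaussBinom q m i) • (x ^ i * y ^ (m + 1 - i)) =
        ∑ i ∈ Finset.range (m + 1),
          (q ^ (i + 1) * gaussBinom q m (i + 1)) • (x ^ (i + 1) * y ^ (m + 1 - (i + 1))) +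
          gaussBinom q (m + 1) 0 • (x ^ 0 * y ^ (m + 1 - 0)) := by
      rw [Finset.sum_range_succ' _ m, Finset.sum_range_succ _ m,
        gaussBinom_eq_zero q (by omega : m < m + 1)]
      simp [gaussBinom_zero_right]
    rw [e2, ← add_assoc, ← Finset.sum_add_distrib]
    congr 1
    refine Finset.sum_congr rfl fun i _ => ?_
    rw [gaussBinom, add_smul, mul_smul_comm, ← mul_assoc, ← pow_succ', Nat.add_sub_add_right]

theorem qcomm_add_pow_of_isPrimitiveRoot {k : Type*} [Field k] [Algebra k R] {q : k} {ℓ : ℕ}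
    (hq : IsPrimitiveRoot q ℓ) (hℓ : 0 < ℓ) {x y : R} (h : y * x = q • (x * y)) :
    (x + y) ^ ℓ = x ^ ℓ + y ^ ℓ := by
  obtain ⟨m, rfl⟩ : ∃ m, ℓ = m + 1 := ⟨ℓ - 1, by omega⟩
  rw [qcomm_add_pow h, Finset.sum_range_succ, Finset.sum_range_succ', gaussBinom_self,
    gaussBinom_zero_right, Finset.sum_eq_zero]
  · simp [add_comm]
  · intro i hi
    have hi := Finset.mem_range.1 hi
    have h1 := gaussBinom_mul q m i
    rw [hq.pow_eq_one, sub_self, zero_mul, mul_eq_zero, sub_eq_zero] at h1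
    rw [h1.resolve_right fun h2 => hq.pow_ne_one_of_pos_of_lt (by omega) (by omega) h2.symm,
      zero_smul]

theorem qcomm_sum_pow {k : Type*} [Field k] [Algebra k R] {q : k} {ℓ : ℕ}
    (hq : IsPrimitiveRoot q ℓ) (hℓ : 0 < ℓ) : ∀ {n : ℕ} (x : Fin n → R)
    (_ : ∀ i j, i < j → x j * x i = q • (x i * x j)), (∑ i, x i) ^ ℓ = ∑ i, x i ^ ℓ
  | 0, x, _ => by simp [hℓ.ne']
  | n + 1, x, h => by
    rw [Fin.sum_univ_succ, Fin.sum_univ_succ, qcomm_add_pow_of_isPrimitiveRoot hq hℓ,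
      qcomm_sum_pow hq hℓ (fun i => x i.succ) fun i j hij => h _ _ (Fin.succ_lt_succ_iff.2 hij)]
    rw [Finset.sum_mul, Finset.mul_sum, Finset.smul_sum]
    exact Finset.sum_congr rfl fun i _ => h _ _ i.succ_pos

end QBinomial

section Powers

variable {k R : Type*} [Field k] [Ring R] [Algebra k R] {n : ℕ} {q : k} {ℓ : ℕ}
  {X : Matrix (Fin n) (Fin n) R}

theorem pow_commute_of_qcomm (hq : q ^ ℓ = 1) {x y : R} (h : y * x = q • (x * y)) :
    Commute (x ^ ℓ) y ∧ Commute (y ^ ℓ) x := by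
  constructor
  · have := qcomm_pow h ℓ
    rw [hq, one_smul] at this
    exact this.symm
  · have : ∀ m, y ^ m * x = q ^ m • (x * y ^ m) := by
      intro m
      induction m with
      | zero => simp
      | succ m ih =>
        rw [pow_succ', mul_assoc, ih, mul_smul_comm, ← mul_assoc, h, smul_mul_assoc, smul_smul,
          mul_assoc, pow_succ]
    have := this ℓ
    rw [hq, one_smul] at this
    exact this

theorem IsQuantumMatrix.pow_commute (hX : IsQuantumMatrix q X) (hq : q ^ ℓ = 1)
    (i r j s : Fin n) : Commute (X i r ^ ℓ) (X j s) := by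
  have cr : ∀ i j r s, i < j → r < s →
      Commute (X i r ^ ℓ) (X j s) ∧ Commute (X j s ^ ℓ) (X i r) := by
    intro i j r s hij hrs
    have h1 := hX.col i j r r hij le_rfl
    have h2 := hX.col i j r s hij hrs.le
    have h3 := hX.col i j s s hij le_rfl
    have h4 := hX.cross i j r s hij hrs
    have h5 := hX.row i r s
    have h6 := hX.row j r s
    generalize X i r = a, X i s = b, X j r = c, X j s = d at *
    constructor
    · have key : ∀ m, d * a ^ m = a ^ m * d + (q ^ m - 1) • (a ^ (m - 1) * (b * c)) := by
        intro m
        induction m with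
        | zero => simp
        | succ m ih =>
          have e : (a ^ (m - 1) * (b * c)) * a = (if m = 0 then q • (a * (b * c)) else
              q • (a ^ m * (b * c))) := by
            have : b * c * a = q • (a * (b * c)) := by
              rw [mul_assoc, h1, mul_smul_comm, ← mul_assoc, ← h5, mul_assoc]
            split_ifs with hm
            · subst hm; simpa using this
            · obtain ⟨m', rfl⟩ := Nat.exists_eq_succ_of_ne_zero hm
              rw [mul_assoc, this, mul_smul_comm, ← mul_assoc, Nat.succ_sub_one, ← pow_succ]
          rw [pow_succ, ← mul_assoc, ih, add_mul, mul_assoc, h4]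
          simp only [smul_mul_assoc, e, Nat.add_sub_cancel]
          split_ifs with hm
          · subst hm; simp
          · simp only [mul_add, mul_smul_comm, smul_smul, mul_assoc]
            module
      have := key ℓ
      rw [hq, sub_self, zero_smul, add_zero] at this
      exact this.symm
    · have key : ∀ m, d ^ (m + 1) * a = a * d ^ (m + 1) + (q ^ (m + 1) - 1) • (b * c * d ^ m) := by
        intro m
        induction m with
        | zero => simpa using h4
        | succ m ih =>
          have e : d * (b * c) = q • (b * c * d) := by
            rw [← mul_assoc, h3, smul_mul_assoc, mul_assoc, ← h6, mul_assoc]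
          rw [pow_succ', mul_assoc, ih, mul_add, ← mul_assoc, h4, mul_smul_comm,
            ← mul_assoc d, e, smul_mul_assoc, mul_assoc (b * c), ← pow_succ', add_mul, mul_assoc,
            ← pow_succ', smul_mul_assoc]
          simp only [pow_succ']
          module
      rcases ℓ with _ | m
      · simp
      · have := key m
        rw [hq, sub_self, zero_smul, add_zero] at this
        exact this
  have cl : ∀ i j r s, i < j → r ≤ s →
      Commute (X i s ^ ℓ) (X j r) ∧ Commute (X j r ^ ℓ) (X i s) :=
    fun i j r s hij hrs => pow_commute_of_qcomm hq (hX.col i j r s hij hrs)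
  rcases lt_trichotomy i j with h | h | h
  · rcases lt_or_ge r s with h' | h'
    · exact (cr i j r s h h').1
    · exact (cl i j s r h h').1
  · subst h
    exact Commute.pow_left (hX.row i r s) ℓ
  · rcases lt_or_ge s r with h' | h'
    · exact (cr j i s r h h').2
    · exact (cl j i r s h h').2

/-- Replacing a row by a linear combination of rows. -/
theorem IsQuantumMatrix.exists_sum_mul_eq (hX : IsQuantumMatrix q X) (a : Fin n → k) (i : Fin n) :
    ∃ s : Fin n → R, ∑ j, (∑ l, a l • X l j) * s j = a i • qdet X := by
  cases n with
  | zero => exact i.elim0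
  | succ m =>
    set f : Fin (m + 1) → Fin (m + 1) := ⇑(Equiv.swap 0 i) with hf
    have hu : ∀ l, qdetRows X (Function.update f 0 l) =
        if l = i then Equiv.Perm.sign (Equiv.swap 0 i) • qdet X else 0 := by
      intro l
      split_ifs with h
      · have : Function.update f 0 l = f := by
          rw [h]; convert Function.update_eq_self 0 f; simp [hf]
        rw [this, hf, ← Function.id_comp (⇑(Equiv.swap 0 i)), hX.qdetRows_comp, qdetRows_id]
      · refine hX.qdetRows_eq_zero _ fun hinj => ?_
        obtain ⟨b, hb⟩ := (Equiv.swap (0 : Fin (m + 1)) i).surjective l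
        have hb0 : b ≠ 0 := by rintro rfl; exact h (by rw [← hb, Equiv.swap_apply_left])
        refine hb0 (hinj ?_)
        rw [Function.update_of_ne hb0, Function.update_self, hf, hb]
    have hexp : ∀ l, qdetRows X (Function.update f 0 l) =
        ∑ σ : Equiv.Perm (Fin (m + 1)), X l (σ 0) * (Equiv.Perm.sign σ •
          (List.ofFn fun p : Fin m => X (f p.succ) (σ p.succ)).prod) := by
      intro l
      refine Finset.sum_congr rfl fun σ _ => ?_
      simp only [List.ofFn_succ, List.prod_cons, Matrix.submatrix_apply, id, Function.update_self]
      rw [mul_smul_comm]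
      congr 3
    refine ⟨fun j => Equiv.Perm.sign (Equiv.swap 0 i) • ∑ σ : Equiv.Perm (Fin (m + 1)),
      if σ 0 = j then Equiv.Perm.sign σ •
          (List.ofFn fun p : Fin m => X (f p.succ) (σ p.succ)).prod else 0, ?_⟩
    simp_rw [mul_smul_comm, Finset.mul_sum, ← Finset.smul_sum]
    rw [Finset.sum_comm]
    simp_rw [mul_ite, mul_zero, Finset.sum_ite_eq, Finset.mem_univ, if_true, Finset.sum_mul,
      smul_mul_assoc]
    rw [Finset.sum_comm]
    simp_rw [← Finset.smul_sum, ← hexp, hu, smul_ite, smul_zero, Finset.sum_ite_eq',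
      Finset.mem_univ, if_true]
    rw [smul_comm (a i), smul_smul, Int.units_mul_self, one_smul]

end Powers

section Units

theorem exists_simple_quotient {A : Type*} [Ring A] {z : A} (hz : ∀ a, z * a = a * z)
    (hu : ∀ a, z * a ≠ 1) :
    ∃ I : TwoSidedIdeal A, z ∈ I ∧ IsSimpleRing I.ringCon.Quotient := by
  obtain ⟨M, hzM, hM⟩ := zorn_le_nonempty₀ {I : TwoSidedIdeal A | (1 : A) ∉ I} (by
    intro c hc hchain J hJ
    refine ⟨TwoSidedIdeal.mk' (⋃ I ∈ c, (I : Set A)) ?_ ?_ ?_ ?_ ?_, ?_, ?_⟩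
    · exact Set.mem_biUnion hJ J.zero_mem
    · intro x y hx hy
      simp only [Set.mem_iUnion, SetLike.mem_coe, exists_prop] at hx hy ⊢
      obtain ⟨I, hI, hx⟩ := hx
      obtain ⟨I', hI', hy⟩ := hy
      rcases hchain.total hI hI' with h | h
      · exact ⟨I', hI', I'.add_mem (h hx) hy⟩
      · exact ⟨I, hI, I.add_mem hx (h hy)⟩
    · intro x hx
      simp only [Set.mem_iUnion, SetLike.mem_coe, exists_prop] at hx ⊢
      obtain ⟨I, hI, hx⟩ := hx
      exact ⟨I, hI, I.neg_mem hx⟩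
    · intro x y hy
      simp only [Set.mem_iUnion, SetLike.mem_coe, exists_prop] at hy ⊢
      obtain ⟨I, hI, hy⟩ := hy
      exact ⟨I, hI, I.mul_mem_left _ _ hy⟩
    · intro x y hx
      simp only [Set.mem_iUnion, SetLike.mem_coe, exists_prop] at hx ⊢
      obtain ⟨I, hI, hx⟩ := hx
      exact ⟨I, hI, I.mul_mem_right _ _ hx⟩
    · simp only [Set.mem_ofPred_eq, TwoSidedIdeal.mem_mk', Set.mem_iUnion, SetLike.mem_coe,
        exists_prop, not_exists, not_and]
      exact fun I hI => hc hI
    · intro I hI x hx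
      rw [TwoSidedIdeal.mem_mk']
      exact Set.mem_biUnion hI hx)
    (TwoSidedIdeal.mk' {x | ∃ a, x = z * a} ⟨0, by simp⟩
      (by rintro _ _ ⟨a, rfl⟩ ⟨b, rfl⟩; exact ⟨a + b, (mul_add _ _ _).symm⟩)
      (by rintro _ ⟨a, rfl⟩; exact ⟨-a, by simp⟩)
      (by rintro x _ ⟨a, rfl⟩; exact ⟨x * a, by rw [← mul_assoc, ← hz, mul_assoc]⟩)
      (by rintro _ y ⟨a, rfl⟩; exact ⟨a * y, by rw [mul_assoc]⟩))
    (by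
      simp only [Set.mem_ofPred_eq, TwoSidedIdeal.mem_mk', not_exists]
      exact fun a h => hu a h.symm)
  refine ⟨M, hzM ?_, ?_⟩
  · rw [TwoSidedIdeal.mem_mk']; exact ⟨1, by simp⟩
  · have h1 : (1 : A) ∉ M := hM.prop
    have hnt : Nontrivial M.ringCon.Quotient := ⟨⟨1, 0, fun h => h1 ((M.mem_iff 1).2
      (Quotient.eq'.1 h))⟩⟩
    refine IsSimpleRing.of_eq_bot_or_eq_top fun J => ?_
    by_cases hJ : (1 : M.ringCon.Quotient) ∈ J
    · exact Or.inr ((TwoSidedIdeal.one_mem_iff J).1 hJ)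
    · left
      have hle : M ≤ TwoSidedIdeal.comap M.ringCon.mk' J := by
        intro x hx
        rw [TwoSidedIdeal.mem_comap]
        have : M.ringCon.mk' x = 0 := Quotient.eq'.2 ((M.mem_iff x).1 hx)
        rw [this]; exact J.zero_mem
      have := hM.le_of_ge (y := TwoSidedIdeal.comap M.ringCon.mk' J)
        (by rw [Set.mem_ofPred_eq, TwoSidedIdeal.mem_comap, map_one]; exact hJ) hle
      refine le_antisymm (fun x hx => ?_) bot_le
      obtain ⟨y, rfl⟩ := M.ringCon.mk'_surjective x
      have hy : y ∈ M := this (by rw [TwoSidedIdeal.mem_comap]; exact hx)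
      rw [TwoSidedIdeal.mem_bot]
      exact Quotient.eq'.2 ((M.mem_iff y).1 hy)

variable {k R : Type*} [Field k] [Ring R] [Algebra k R] {n : ℕ} {q : k} {ℓ : ℕ}
  {X : Matrix (Fin n) (Fin n) R}

theorem qdet_map {S F : Type*} [Ring S] [FunLike F R S] [RingHomClass F R S] (φ : F) 
    (X : Matrix (Fin n) (Fin n) R) : qdet (X.map φ) = φ (qdet X) := by
  simp only [qdet, map_sum, Matrix.map_apply]
  refine Finset.sum_congr rfl fun σ _ => ?_
  rw [Units.smul_def, Units.smul_def, map_zsmul, map_list_prod, List.map_ofFn]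
  rfl

theorem IsQuantumMatrix.map {k' S : Type*} [CommRing k'] [Ring S] [Algebra k' S] {q' : k'}
    (hX : IsQuantumMatrix q X) (φ : R →+* S) (hφ : ∀ x, φ (q • x) = q' • φ x) :
    IsQuantumMatrix q' (X.map φ) where
  row i r s := by simp only [Matrix.map_apply, ← map_mul, hX.row i r s]
  col i j r s h h' := by simp only [Matrix.map_apply, ← map_mul, hX.col i j r s h h', hφ]
  cross i j r s h h' := by
    simp only [Matrix.map_apply, ← map_mul, hX.cross i j r s h h', map_add, sub_smul, one_smul,
      map_sub, hφ]

theorem IsQuantumMatrix.eq_zero_of_sum_pow_eq_zero [IsAlgClosed k] [Nontrivial R]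
    (hX : IsQuantumMatrix q X) (hd : IsUnit (qdet X)) (hq : IsPrimitiveRoot q ℓ) (hℓ : 0 < ℓ)
    (v : Fin n → k) (hv : ∀ j, ∑ i, v i • X i j ^ ℓ = 0) : v = 0 := by
  choose a ha using fun i => IsAlgClosed.exists_pow_nat_eq (v i) hℓ
  set w : Fin n → R := fun j => ∑ i, a i • X i j with hw
  have hw0 : ∀ j, w j ^ ℓ = 0 := by
    intro j
    rw [hw, qcomm_sum_pow hq hℓ]
    · simpa only [smul_pow, ha] using hv j
    · intro i i' h
      simp only [smul_mul_smul_comm, hX.col i i' j j h le_rfl]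
      rw [smul_comm q, mul_comm (a i')]
  have hwc : ∀ r s, Commute (w r) (w s) := by
    intro r s
    simp only [Commute, SemiconjBy, hw, Finset.sum_mul_sum, smul_mul_smul_comm]
    refine sum_sum_eq_of_pairs _ _ (fun i => by rw [hX.row i r s]) fun i j _ => ?_
    rw [mul_comm (a j), ← smul_add, ← smul_add, hX.symm_cols]
  funext i
  by_contra hi
  have hai : a i ≠ 0 := by
    rintro h
    apply hi
    rw [← ha i, h, zero_pow hℓ.ne']; rfl
  obtain ⟨s, hs⟩ := hX.exists_sum_mul_eq a i
  obtain ⟨u, hu⟩ := hd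
  have h1 : ∑ j, w j * (s j * ((a i)⁻¹ • (↑u⁻¹ : R))) = 1 := by
    simp_rw [← mul_assoc]
    rw [← Finset.sum_mul, hs, ← hu, smul_mul_smul_comm, mul_inv_cancel₀ hai, Units.mul_inv,
      one_smul]
  have key : ∀ S : Finset (Fin n), ∃ P : R, P ≠ 0 ∧ ∀ j ∈ S, P * w j = 0 := by
    intro S
    induction S using Finset.induction_on with
    | empty => exact ⟨1, one_ne_zero, by simp⟩
    | insert j S hj ih =>
      obtain ⟨P, hP, hPS⟩ := ih
      have hex : ∃ m, P * w j ^ m = 0 := ⟨ℓ, by rw [hw0, mul_zero]⟩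
      classical
      obtain ⟨m, hm⟩ : ∃ m, Nat.find hex = m + 1 := by
        refine Nat.exists_eq_succ_of_ne_zero fun h => hP ?_
        have := Nat.find_spec hex
        rwa [h, pow_zero, mul_one] at this
      refine ⟨P * w j ^ m, Nat.find_min hex (by omega), fun l hl => ?_⟩
      rcases Finset.mem_insert.1 hl with rfl | hl
      · have := Nat.find_spec hex
        rwa [hm, pow_succ, ← mul_assoc] at this
      · rw [mul_assoc, ((hwc j l).pow_left m).eq, ← mul_assoc, hPS l hl, zero_mul]
  obtain ⟨P, hP, hPw⟩ := key Finset.univ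
  apply hP
  rw [← mul_one P, ← h1, Finset.mul_sum]
  exact Finset.sum_eq_zero fun j hj => by rw [← mul_assoc, hPw j hj, zero_mul]

theorem IsQuantumMatrix.eq_zero_of_sum_pow_eq_zero' [Nontrivial R]
    (hX : IsQuantumMatrix q X) (hd : IsUnit (qdet X)) (hq : IsPrimitiveRoot q ℓ) (hℓ : 0 < ℓ)
    (v : Fin n → k) (hv : ∀ j, ∑ i, v i • X i j ^ ℓ = 0) : v = 0 := by
  let θ : R →ₐ[k] TensorProduct k (AlgebraicClosure k) R := Algebra.TensorProduct.includeRight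
  have hθ : ∀ (c : k) (x : R), θ (c • x) = algebraMap k (AlgebraicClosure k) c • θ x := by
    intro c x
    rw [map_smul, algebraMap_smul]
  have h := (hX.map (q' := algebraMap k (AlgebraicClosure k) q) θ.toRingHom (hθ q)).eq_zero_of_sum_pow_eq_zero
    (by rw [qdet_map]; exact hd.map _)
    (hq.map_of_injective (algebraMap k (AlgebraicClosure k)).injective) hℓ
    (fun i => algebraMap k _ (v i)) (fun j => by
      have := congrArg θ (hv j)
      rw [map_sum, map_zero] at this
      simpa [hθ] using this)
  funext i
  have := congrFun h i
  simpa using this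

/-- The determinant of the matrix of `ℓ`-th powers of the entries (which are central). -/
theorem IsQuantumMatrix.isUnit_det_pow (hX : IsQuantumMatrix q X) (hd : IsUnit (qdet X))
    (hq : IsPrimitiveRoot q ℓ) (hℓ : 0 < ℓ) (C : Matrix (Fin n) (Fin n) (Subalgebra.center k R))
    (hC : ∀ i j, (C i j : R) = X i j ^ ℓ) : IsUnit C.det := by
  have hz : ∀ a, (C.det : R) * a = a * C.det := fun a =>
    ((Subalgebra.mem_center_iff.1 C.det.2) a).symm
  by_cases hu : ∃ a, (C.det : R) * a = 1
  · obtain ⟨a, ha⟩ := hu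
    have hac : a ∈ Subalgebra.center k R := by
      rw [Subalgebra.mem_center_iff]
      intro b
      calc b * a = (a * C.det) * (b * a) := by rw [← hz, ha, one_mul]
        _ = a * (C.det * b) * a := by simp only [mul_assoc]
        _ = a * b * (C.det * a) := by rw [hz]; simp only [mul_assoc]
        _ = a * b := by rw [ha, mul_one]
    exact IsUnit.of_mul_eq_one ⟨a, hac⟩ (Subtype.ext ha)
  · exfalso
    push Not at hu
    obtain ⟨I, hzI, hI⟩ := exists_simple_quotient hz hu
    let Q := I.ringCon.Quotient
    let π : R →+* Q := I.ringCon.mk'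
    have hπ : Function.Surjective π := I.ringCon.mk'_surjective
    let _ : Field (Subring.center Q) := (IsSimpleRing.isField_center Q).toField
    let φ : Subalgebra.center k R →+* Subring.center Q :=
      (π.comp (Subalgebra.center k R).val.toRingHom).codRestrict (Subring.center Q) (by
        intro x
        rw [Subring.mem_center_iff]
        intro y
        obtain ⟨y, rfl⟩ := hπ y
        change π y * π x = π x * π y
        rw [← map_mul, ← map_mul, Subalgebra.mem_center_iff.1 x.2 y])
    have hφ : ∀ c, ((φ c : Subring.center Q) : Q) = π c := fun _ => rfl
    let ψ : k →+* Subring.center Q := φ.comp (algebraMap k (Subalgebra.center k R))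
    have hdet : (φ.mapMatrix C).det = 0 := by
      rw [← RingHom.map_det]
      refine Subtype.ext ?_
      rw [hφ]
      exact Quotient.eq'.2 ((I.mem_iff _).1 hzI)
    obtain ⟨v, hv0, hv⟩ := Matrix.exists_vecMul_eq_zero_iff.2 hdet
    apply hv0
    refine (hX.map (q' := ψ q) π ?_).eq_zero_of_sum_pow_eq_zero' (ℓ := ℓ)
      (by rw [qdet_map]; exact hd.map _) (hq.map_of_injective ψ.injective) hℓ v fun j => ?_
    · intro x
      rw [Algebra.smul_def, map_mul]
      rfl
    · have := congrArg (Subtype.val : Subring.center Q → Q) (congrFun hv j)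
      simp only [Matrix.vecMul, dotProduct, RingHom.mapMatrix_apply, Matrix.map_apply,
        AddSubmonoidClass.coe_finsetSum, Subring.coe_mul, hφ, hC, map_pow] at this
      exact this

end Units

/-! ## The coordinate bialgebra of the quantum general linear group -/

section QuantumGL

/-- Generators for the coordinate algebra of quantum `GL_n`: the coordinate functions, and one
generator for the inverse of the quantum determinant. -/
abbrev QuantumGLGen (n : ℕ) := (Fin n × Fin n) ⊕ Unit

/-- The defining relations of the localisation of `A_q(n)` at its quantum determinant: the
relations of `A_q(n)` between the coordinate functions, and the relations saying that the additional
generator is a two-sided inverse of the quantum determinant. -/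
inductive QuantumGLRel (k : Type*) [Field k] (n : ℕ) (q : k) :
    FreeAlgebra k (QuantumGLGen n) → FreeAlgebra k (QuantumGLGen n) → Prop
  | row (i r s : Fin n) : QuantumGLRel k n q
      (FreeAlgebra.ι k (Sum.inl (i, r)) * FreeAlgebra.ι k (Sum.inl (i, s)))
      (FreeAlgebra.ι k (Sum.inl (i, s)) * FreeAlgebra.ι k (Sum.inl (i, r)))
  | col (i j r s : Fin n) (_ : i < j) (_ : r ≤ s) : QuantumGLRel k n q
      (FreeAlgebra.ι k (Sum.inl (j, r)) * FreeAlgebra.ι k (Sum.inl (i, s)))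
      (q • (FreeAlgebra.ι k (Sum.inl (i, s)) * FreeAlgebra.ι k (Sum.inl (j, r))))
  | cross (i j r s : Fin n) (_ : i < j) (_ : r < s) : QuantumGLRel k n q
      (FreeAlgebra.ι k (Sum.inl (j, s)) * FreeAlgebra.ι k (Sum.inl (i, r)))
      (FreeAlgebra.ι k (Sum.inl (i, r)) * FreeAlgebra.ι k (Sum.inl (j, s)) +
        (q - 1) • (FreeAlgebra.ι k (Sum.inl (i, s)) * FreeAlgebra.ι k (Sum.inl (j, r))))
  | qdet_mul_inv : QuantumGLRel k n q
      (qdet (Matrix.of fun i j => FreeAlgebra.ι k (Sum.inl (i, j))) *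
        FreeAlgebra.ι k (Sum.inr ())) 1
  | inv_mul_qdet : QuantumGLRel k n q
      (FreeAlgebra.ι k (Sum.inr ()) *
        qdet (Matrix.of fun i j => FreeAlgebra.ι k (Sum.inl (i, j)))) 1

/-- The coordinate algebra `k[G]` of the quantum general linear group `G` of Dipper and Donkin:
the localisation of `A_q(n)` at the quantum determinant, which is the universal algebra over
`A_q(n)` in which the quantum determinant is invertible. -/
def QuantumGL (k : Type*) [Field k] (n : ℕ) (q : k) : Type _ := RingQuot (QuantumGLRel k n q)

namespace QuantumGL

variable {k : Type*} [Field k] {n : ℕ} {q : k}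

instance : Ring (QuantumGL k n q) := inferInstanceAs (Ring (RingQuot (QuantumGLRel k n q)))

instance : Algebra k (QuantumGL k n q) :=
  inferInstanceAs (Algebra k (RingQuot (QuantumGLRel k n q)))

variable (k n q) in
/-- The matrix of coordinate functions `c_{ij}` of quantum `GL_n`. -/
noncomputable def coord : Matrix (Fin n) (Fin n) (QuantumGL k n q) :=
  Matrix.of fun i j => RingQuot.mkAlgHom k (QuantumGLRel k n q) (FreeAlgebra.ι k (Sum.inl (i, j)))

theorem coord_isQuantumMatrix : IsQuantumMatrix q (coord k n q) where
  row i r s := by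
    have := RingQuot.mkAlgHom_rel k (QuantumGLRel.row (k := k) (q := q) i r s)
    simpa only [map_mul] using! this
  col i j r s h h' := by
    have := RingQuot.mkAlgHom_rel k (QuantumGLRel.col (k := k) (q := q) i j r s h h')
    simpa only [map_mul, map_smul] using! this
  cross i j r s h h' := by
    have := RingQuot.mkAlgHom_rel k (QuantumGLRel.cross (k := k) (q := q) i j r s h h')
    simpa only [map_mul, map_smul, map_add] using! this

variable (k n q) in
/-- The inverse of the quantum determinant in `k[G]`. -/
noncomputable def dinv : QuantumGL k n q :=
  RingQuot.mkAlgHom k (QuantumGLRel k n q) (FreeAlgebra.ι k (Sum.inr ()))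

theorem qdet_mul_dinv : qdet (coord k n q) * dinv k n q = 1 := by
  have h1 := RingQuot.mkAlgHom_rel k (QuantumGLRel.qdet_mul_inv (k := k) (n := n) (q := q))
  rw [map_mul, map_one, ← qdet_map] at h1
  exact h1

theorem dinv_mul_qdet : dinv k n q * qdet (coord k n q) = 1 := by
  have h1 := RingQuot.mkAlgHom_rel k (QuantumGLRel.inv_mul_qdet (k := k) (n := n) (q := q))
  rw [map_mul, map_one, ← qdet_map] at h1
  exact h1

theorem isUnit_qdet_coord : IsUnit (qdet (coord k n q)) :=
  ⟨⟨_, _, qdet_mul_dinv, dinv_mul_qdet⟩, rfl⟩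

theorem commute_of_commute_coord {z : QuantumGL k n q}
    (hz : ∀ i j, Commute z (coord k n q i j)) (a : QuantumGL k n q) : Commute z a := by
  have hd : Commute z (qdet (coord k n q)) := by
    refine Commute.sum_right _ _ _ fun σ _ => ?_
    rw [Units.smul_def]
    refine Commute.smul_right (Commute.list_prod_right _ _ fun x hx => ?_) _
    obtain ⟨i, rfl⟩ := (List.mem_ofFn' _ _).1 hx
    exact hz _ _
  have hi : Commute z (dinv k n q) :=
    Commute.units_inv_right (u := ⟨_, _, qdet_mul_dinv, dinv_mul_qdet⟩) hd
  obtain ⟨a, rfl⟩ := RingQuot.mkAlgHom_surjective k (QuantumGLRel k n q) a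
  induction a using FreeAlgebra.induction with
  | grade0 r => exact (AlgHom.commutes (RingQuot.mkAlgHom k (QuantumGLRel k n q)) r).symm ▸
      Algebra.commute_algebraMap_right r z
  | grade1 x =>
    obtain ⟨i, j⟩ | ⟨⟩ := x
    · exact hz i j
    · exact hi
  | mul a b ha hb =>
    rw [map_mul]
    exact Commute.mul_right ha hb
  | add a b ha hb =>
    rw [map_add]
    exact Commute.add_right ha hb

variable {B : Type*} [Ring B] [Algebra k B]

/-- The universal property of `k[G]`: algebra maps out of it correspond to quantum matrices with
invertible quantum determinant. -/
noncomputable def lift (X : Matrix (Fin n) (Fin n) B) (hX : IsQuantumMatrix q X) (hd : IsUnit (qdet X)) :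
    QuantumGL k n q →ₐ[k] B :=
  RingQuot.liftAlgHom k ⟨FreeAlgebra.lift k
      (Sum.elim (fun p => X p.1 p.2) fun _ => (↑hd.unit⁻¹ : B)), by
    have hq : FreeAlgebra.lift k (Sum.elim (fun p => X p.1 p.2) fun _ : Unit => (↑hd.unit⁻¹ : B))
        (qdet (Matrix.of fun i j : Fin n => FreeAlgebra.ι k (Sum.inl (i, j)))) = qdet X := by
      rw [← qdet_map]
      congr 1
      ext i j
      simp
    intro x y h
    induction h with
    | row i r s => simpa using hX.row i r s
    | col i j r s h h' => simpa using hX.col i j r s h h'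
    | cross i j r s h h' => simpa using hX.cross i j r s h h'
    | qdet_mul_inv => rw [map_mul, hq, map_one]; simp
    | inv_mul_qdet => rw [map_mul, hq, map_one]; simp⟩

@[simp]
theorem lift_coord (X : Matrix (Fin n) (Fin n) B) (hX : IsQuantumMatrix q X)
    (hd : IsUnit (qdet X)) (i j : Fin n) : lift X hX hd (coord k n q i j) = X i j := by
  refine (RingQuot.liftAlgHom_mkAlgHom_apply k _ _ _).trans ?_
  simp

theorem algHom_ext {f g : QuantumGL k n q →ₐ[k] B}
    (h : ∀ i j, f (coord k n q i j) = g (coord k n q i j)) : f = g := by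
  have hm : (coord k n q).map f = (coord k n q).map g := by ext i j; exact h i j
  have hdet : f (qdet (coord k n q)) = g (qdet (coord k n q)) := by
    rw [← qdet_map, ← qdet_map, hm]
  refine RingQuot.ringQuot_ext' k _ _ (FreeAlgebra.hom_ext (funext fun x => ?_))
  obtain ⟨i, j⟩ | ⟨⟩ := x
  · exact h i j
  · have h1 := congrArg g (qdet_mul_dinv (k := k) (n := n) (q := q))
    have h2 := congrArg f (dinv_mul_qdet (k := k) (n := n) (q := q))
    rw [map_mul, map_one] at h1 h2
    rw [hdet] at h2
    exact left_inv_eq_right_inv h2 h1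

variable (k n q) in
theorem isQuantumMatrix_comul :
    IsQuantumMatrix q ((coord k n q).map (Algebra.TensorProduct.includeLeft :
        QuantumGL k n q →ₐ[k] QuantumGL k n q ⊗[k] QuantumGL k n q) *
      (coord k n q).map (Algebra.TensorProduct.includeRight :
        QuantumGL k n q →ₐ[k] QuantumGL k n q ⊗[k] QuantumGL k n q)) ∧
    IsUnit (qdet ((coord k n q).map (Algebra.TensorProduct.includeLeft :
        QuantumGL k n q →ₐ[k] QuantumGL k n q ⊗[k] QuantumGL k n q) *
      (coord k n q).map (Algebra.TensorProduct.includeRight :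
        QuantumGL k n q →ₐ[k] QuantumGL k n q ⊗[k] QuantumGL k n q))) := by
  have h1 := coord_isQuantumMatrix (k := k) (n := n) (q := q)
  have hl := h1.map (q' := q) (Algebra.TensorProduct.includeLeft :
        QuantumGL k n q →ₐ[k] QuantumGL k n q ⊗[k] QuantumGL k n q).toRingHom
        (fun x => map_smul (Algebra.TensorProduct.includeLeft :
        QuantumGL k n q →ₐ[k] QuantumGL k n q ⊗[k] QuantumGL k n q) q x)
  have hr := h1.map (q' := q) (Algebra.TensorProduct.includeRight :
        QuantumGL k n q →ₐ[k] QuantumGL k n q ⊗[k] QuantumGL k n q).toRingHom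
        (fun x => map_smul (Algebra.TensorProduct.includeRight :
        QuantumGL k n q →ₐ[k] QuantumGL k n q ⊗[k] QuantumGL k n q) q x)
  have hc : ∀ a b : QuantumGL k n q, Commute
      ((Algebra.TensorProduct.includeLeft :
        QuantumGL k n q →ₐ[k] QuantumGL k n q ⊗[k] QuantumGL k n q) a)
      ((Algebra.TensorProduct.includeRight :
        QuantumGL k n q →ₐ[k] QuantumGL k n q ⊗[k] QuantumGL k n q) b) := fun a b => by
    simp [Commute, SemiconjBy]
  refine ⟨hl.mul hr fun i j r s => hc _ _, ?_⟩
  have := hr.qdet_mul (X := (coord k n q).map (Algebra.TensorProduct.includeLeft :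
        QuantumGL k n q →ₐ[k] QuantumGL k n q ⊗[k] QuantumGL k n q)) fun i j r s => hc _ _
  refine this ▸ IsUnit.mul ?_ ?_
  · rw [qdet_map]; exact isUnit_qdet_coord.map _
  · rw [qdet_map]; exact isUnit_qdet_coord.map _

variable (k n q) in
/-- The comultiplication of `k[G]`, determined by `c_{ij} ↦ ∑_r c_{ir} ⊗ c_{rj}`. -/
noncomputable def comulHom : QuantumGL k n q →ₐ[k] QuantumGL k n q ⊗[k] QuantumGL k n q :=
  lift _ (isQuantumMatrix_comul k n q).1 (isQuantumMatrix_comul k n q).2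

theorem comulHom_coord (i j : Fin n) : comulHom k n q (coord k n q i j) =
    ∑ r, coord k n q i r ⊗ₜ[k] coord k n q r j := by
  rw [comulHom, lift_coord, Matrix.mul_apply]
  simp

theorem isQuantumMatrix_one : IsQuantumMatrix q (1 : Matrix (Fin n) (Fin n) k) where
  row i r s := mul_comm _ _
  col i j r s h h' := by
    by_cases h1 : j = r
    · have : i ≠ s := by rintro rfl; exact absurd (h1 ▸ h) h'.not_gt
      simp [Matrix.one_apply, this]
    · simp [Matrix.one_apply, h1]
  cross i j r s h h' := by
    by_cases h1 : j = r
    · have : i ≠ s := by rintro rfl; exact absurd (h1 ▸ h) h'.not_gt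
      simp [Matrix.one_apply, this, mul_comm]
    · simp [Matrix.one_apply, h1, mul_comm]

theorem qdet_eq_det {S : Type*} [CommRing S] (X : Matrix (Fin n) (Fin n) S) :
    qdet X = X.det := by
  rw [← Matrix.det_transpose, Matrix.det_apply]
  simp [qdet, List.prod_ofFn]

variable (k n q) in
/-- The counit of `k[G]`, determined by `c_{ij} ↦ δ_{ij}`. -/
noncomputable def counitHom : QuantumGL k n q →ₐ[k] k :=
  lift 1 isQuantumMatrix_one (by rw [qdet_eq_det, Matrix.det_one]; exact isUnit_one)

theorem counitHom_coord (i j : Fin n) : counitHom k n q (coord k n q i j) =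
    if i = j then 1 else 0 := by
  rw [counitHom, lift_coord, Matrix.one_apply]

/-- The bialgebra structure of `k[G]`. (The antipode is determined by it and is not involved in
the notions of module, tensor product and twist below.) -/
noncomputable instance : Bialgebra k (QuantumGL k n q) :=
  Bialgebra.ofAlgHom (comulHom k n q) (counitHom k n q)
    (algHom_ext fun i j => by
      simp only [AlgHom.comp_apply, comulHom_coord, map_sum, Algebra.TensorProduct.map_tmul,
        AlgHom.id_apply, TensorProduct.sum_tmul, TensorProduct.tmul_sum]
      rw [Finset.sum_comm]
      rfl)
    (algHom_ext fun i j => by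
      simp [comulHom_coord, counitHom_coord, TensorProduct.ite_tmul])
    (algHom_ext fun i j => by
      simp [comulHom_coord, counitHom_coord, TensorProduct.tmul_ite])

theorem comul_coord (i j : Fin n) : Coalgebra.comul (R := k) (coord k n q i j) =
    ∑ r, coord k n q i r ⊗ₜ[k] coord k n q r j := comulHom_coord i j

theorem counit_coord (i j : Fin n) : Coalgebra.counit (R := k) (coord k n q i j) =
    if i = j then 1 else 0 := counitHom_coord i j

end QuantumGL

end QuantumGL

/-! ## The coordinate bialgebra of the classical general linear group -/

section ClassicalGL

/-- The coordinate algebra of the algebraic group `GL_n` over `k`: the polynomial algebra in `n²`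
commuting variables `y_{ij}`, localised at the determinant of the matrix `(y_{ij})`. -/
abbrev ClassicalGL (k : Type*) [Field k] (n : ℕ) : Type _ :=
  Localization.Away (Matrix.det (Matrix.mvPolynomialX (Fin n) (Fin n) k))

namespace ClassicalGL

variable {k : Type*} [Field k] {n : ℕ}

variable (k n) in
/-- The matrix of coordinate functions `y_{ij}` of `GL_n`. -/
noncomputable def coord : Matrix (Fin n) (Fin n) (ClassicalGL k n) :=
  (Matrix.mvPolynomialX (Fin n) (Fin n) k).map (algebraMap _ _)

theorem isUnit_det_coord : IsUnit (coord k n).det := by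
  have : (coord k n).det = algebraMap _ (ClassicalGL k n)
      (Matrix.det (Matrix.mvPolynomialX (Fin n) (Fin n) k)) := by
    rw [RingHom.map_det]; rfl
  rw [this]
  exact IsLocalization.Away.algebraMap_isUnit _

/-- Algebra maps to commutative algebras correspond to invertible matrices. -/
noncomputable def lift {B : Type*} [CommRing B] [Algebra k B] (X : Matrix (Fin n) (Fin n) B)
    (hX : IsUnit X.det) : ClassicalGL k n →ₐ[k] B :=
  IsLocalization.liftAlgHom (M := Submonoid.powers
      (Matrix.det (Matrix.mvPolynomialX (Fin n) (Fin n) k)))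
    (f := MvPolynomial.aeval fun p : Fin n × Fin n => X p.1 p.2) (by
      rintro ⟨_, m, rfl⟩
      rw [map_pow, AlgHom.map_det, AlgHom.mapMatrix_apply]
      refine IsUnit.pow m ?_
      convert hX
      ext i j
      simp [Matrix.mvPolynomialX])

@[simp]
theorem lift_coord {B : Type*} [CommRing B] [Algebra k B] (X : Matrix (Fin n) (Fin n) B)
    (hX : IsUnit X.det) (i j : Fin n) : lift X hX (coord k n i j) = X i j := by
  have : coord k n i j = algebraMap (MvPolynomial (Fin n × Fin n) k) (ClassicalGL k n)
      (MvPolynomial.X (i, j)) := by simp [coord, Matrix.mvPolynomialX]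
  rw [this, lift, IsLocalization.liftAlgHom_apply]
  exact (IsLocalization.lift_eq _ _).trans (MvPolynomial.aeval_X _ _)

theorem algHom_ext {B : Type*} [Ring B] [Algebra k B] {f g : ClassicalGL k n →ₐ[k] B}
    (h : ∀ i j, f (coord k n i j) = g (coord k n i j)) : f = g := by
  refine AlgHom.coe_ringHom_injective (IsLocalization.ringHom_ext (Submonoid.powers
      (Matrix.det (Matrix.mvPolynomialX (Fin n) (Fin n) k))) ?_)
  refine RingHom.ext fun p => ?_
  change f (algebraMap _ _ p) = g (algebraMap _ _ p)
  induction p using MvPolynomial.induction_on with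
  | C a =>
    rw [← MvPolynomial.algebraMap_eq, ← IsScalarTower.algebraMap_apply, f.commutes, g.commutes]
  | add p p' hp hp' => rw [map_add, map_add, map_add, hp, hp']
  | mul_X p v hp =>
    rw [map_mul, map_mul, map_mul, hp]
    congr 1
    simpa [coord, Matrix.mvPolynomialX] using h v.1 v.2

variable (k n) in
theorem isUnit_det_comul :
    IsUnit ((coord k n).map (Algebra.TensorProduct.includeLeft :
        ClassicalGL k n →ₐ[k] ClassicalGL k n ⊗[k] ClassicalGL k n) *
      (coord k n).map (Algebra.TensorProduct.includeRight :
        ClassicalGL k n →ₐ[k] ClassicalGL k n ⊗[k] ClassicalGL k n)).det := by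
  rw [Matrix.det_mul]
  refine IsUnit.mul ?_ ?_
  · exact (AlgHom.map_det (Algebra.TensorProduct.includeLeft :
        ClassicalGL k n →ₐ[k] ClassicalGL k n ⊗[k] ClassicalGL k n) (coord k n)) ▸
      isUnit_det_coord.map _
  · exact (AlgHom.map_det (Algebra.TensorProduct.includeRight :
        ClassicalGL k n →ₐ[k] ClassicalGL k n ⊗[k] ClassicalGL k n) (coord k n)) ▸
      isUnit_det_coord.map _

variable (k n) in
/-- The comultiplication of `k[GL_n]`, determined by `y_{ij} ↦ ∑_r y_{ir} ⊗ y_{rj}`. -/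
noncomputable def comulHom : ClassicalGL k n →ₐ[k] ClassicalGL k n ⊗[k] ClassicalGL k n :=
  lift _ (isUnit_det_comul k n)

theorem comulHom_coord (i j : Fin n) : comulHom k n (coord k n i j) =
    ∑ r, coord k n i r ⊗ₜ[k] coord k n r j := by
  rw [comulHom, lift_coord, Matrix.mul_apply]
  simp

variable (k n) in
/-- The counit of `k[GL_n]`, determined by `y_{ij} ↦ δ_{ij}`. -/
noncomputable def counitHom : ClassicalGL k n →ₐ[k] k :=
  lift 1 (by rw [Matrix.det_one]; exact isUnit_one)

theorem counitHom_coord (i j : Fin n) : counitHom k n (coord k n i j) =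
    if i = j then 1 else 0 := by
  rw [counitHom, lift_coord, Matrix.one_apply]

/-- The bialgebra structure of `k[GL_n]`. -/
noncomputable instance : Bialgebra k (ClassicalGL k n) :=
  Bialgebra.ofAlgHom (comulHom k n) (counitHom k n)
    (algHom_ext fun i j => by
      simp only [AlgHom.comp_apply, comulHom_coord, map_sum, Algebra.TensorProduct.map_tmul,
        AlgHom.id_apply, TensorProduct.sum_tmul, TensorProduct.tmul_sum]
      rw [Finset.sum_comm]
      rfl)
    (algHom_ext fun i j => by
      simp [comulHom_coord, counitHom_coord, TensorProduct.ite_tmul])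
    (algHom_ext fun i j => by
      simp [comulHom_coord, counitHom_coord, TensorProduct.tmul_ite])

theorem comul_coord (i j : Fin n) : Coalgebra.comul (R := k) (coord k n i j) =
    ∑ r, coord k n i r ⊗ₜ[k] coord k n r j := comulHom_coord i j

theorem counit_coord (i j : Fin n) : Coalgebra.counit (R := k) (coord k n i j) =
    if i = j then 1 else 0 := counitHom_coord i j

end ClassicalGL

end ClassicalGL

/-! ## The quantum Frobenius morphism -/

section Frobenius

variable {k : Type*} [Field k] {n : ℕ} {q : k} {ℓ : ℕ}

/-- The matrix of the (central) elements `c_{ij}^ℓ`. -/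
noncomputable def frobeniusMatrix (n : ℕ) (hq : IsPrimitiveRoot q ℓ) :
    Matrix (Fin n) (Fin n) (Subalgebra.center k (QuantumGL k n q)) :=
  Matrix.of fun i j => ⟨QuantumGL.coord k n q i j ^ ℓ, by
    rw [Subalgebra.mem_center_iff]
    exact fun b => (QuantumGL.commute_of_commute_coord (fun r s =>
      QuantumGL.coord_isQuantumMatrix.pow_commute hq.pow_eq_one i j r s) b).symm⟩

/-- The algebra map `k[GL_n] → k[G]` with `y_{ij} ↦ c_{ij}^ℓ`; it takes values in the centre. -/
noncomputable def frobeniusAlgHom (n : ℕ) (hq : IsPrimitiveRoot q ℓ) (hℓ : 0 < ℓ) :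
    ClassicalGL k n →ₐ[k] QuantumGL k n q :=
  (Subalgebra.center k (QuantumGL k n q)).val.comp (ClassicalGL.lift (frobeniusMatrix n hq)
    (QuantumGL.coord_isQuantumMatrix.isUnit_det_pow QuantumGL.isUnit_qdet_coord hq hℓ _
      fun _ _ => rfl))

theorem frobeniusAlgHom_coord (hq : IsPrimitiveRoot q ℓ) (hℓ : 0 < ℓ) (i j : Fin n) :
    frobeniusAlgHom n hq hℓ (ClassicalGL.coord k n i j) = QuantumGL.coord k n q i j ^ ℓ := by
  rw [frobeniusAlgHom, AlgHom.comp_apply, ClassicalGL.lift_coord]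
  rfl

/-- The comorphism `k[GL_n] → k[G]` of the quantum Frobenius morphism `F : G → GL_n`: the
bialgebra map with `y_{ij} ↦ c_{ij}^ℓ`. -/
noncomputable def quantumFrobenius (n : ℕ) (hq : IsPrimitiveRoot q ℓ) (hℓ : 0 < ℓ) :
    ClassicalGL k n →ₐc[k] QuantumGL k n q :=
  BialgHom.ofAlgHom (frobeniusAlgHom n hq hℓ)
    (ClassicalGL.algHom_ext fun i j => by
      change Bialgebra.counitAlgHom k _ (frobeniusAlgHom n hq hℓ _) =
        Coalgebra.counit (ClassicalGL.coord k n i j)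
      rw [frobeniusAlgHom_coord, map_pow, ClassicalGL.counit_coord]
      change (Coalgebra.counit (R := k) (QuantumGL.coord k n q i j)) ^ ℓ = _
      rw [QuantumGL.counit_coord]
      split_ifs
      · exact one_pow ℓ
      · exact zero_pow hℓ.ne')
    (ClassicalGL.algHom_ext fun i j => by
      change Algebra.TensorProduct.map _ _ (Coalgebra.comul (R := k) _) =
        Bialgebra.comulAlgHom k _ (frobeniusAlgHom n hq hℓ _)
      rw [frobeniusAlgHom_coord, map_pow, ClassicalGL.comul_coord]
      change _ = (QuantumGL.comulHom k n q (QuantumGL.coord k n q i j)) ^ ℓ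
      rw [QuantumGL.comulHom_coord, qcomm_sum_pow hq hℓ, map_sum]
      · simp [frobeniusAlgHom_coord]
      · intro r s hrs
        have h := QuantumGL.coord_isQuantumMatrix (k := k) (n := n) (q := q)
        rw [Algebra.TensorProduct.tmul_mul_tmul, Algebra.TensorProduct.tmul_mul_tmul,
          h.col r s j j hrs le_rfl, h.row i s r, TensorProduct.tmul_smul])

theorem quantumFrobenius_coord (hq : IsPrimitiveRoot q ℓ) (hℓ : 0 < ℓ) (i j : Fin n) :
    quantumFrobenius n hq hℓ (ClassicalGL.coord k n i j) = QuantumGL.coord k n q i j ^ ℓ :=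
  frobeniusAlgHom_coord hq hℓ i j

end Frobenius

/-! ## Modules of a quantum group -/

section Modules

variable {k : Type*} [Field k]

/-- A module of the quantum group with coordinate bialgebra `A` on the `k`-space `V`: a right
`A`-comodule structure `V → V ⊗ A`. -/
structure GroupModule (k A V : Type*) [Field k] [Ring A] [Bialgebra k A] [AddCommGroup V]
    [Module k V] where
  /-- The structure map. -/
  coact : V →ₗ[k] V ⊗[k] A
  coassoc : (TensorProduct.assoc k V A A).toLinearMap ∘ₗ coact.rTensor A ∘ₗ coact =
    (Coalgebra.comul (R := k) (A := A)).lTensor V ∘ₗ coact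
  counit : (TensorProduct.rid k V).toLinearMap ∘ₗ
    (Coalgebra.counit (R := k) (A := A)).lTensor V ∘ₗ coact = LinearMap.id

/-- An isomorphism of modules of a quantum group: a linear isomorphism commuting with the
structure maps. -/
structure GroupModule.Iso {A V W : Type*} [Ring A] [Bialgebra k A] [AddCommGroup V] [Module k V]
    [AddCommGroup W] [Module k W] (ρ : GroupModule k A V) (σ : GroupModule k A W) extends
    V ≃ₗ[k] W where
  map_coact : σ.coact ∘ₗ toLinearEquiv.toLinearMap =
    toLinearEquiv.toLinearMap.rTensor A ∘ₗ ρ.coact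

variable {A A' V W : Type*} [Ring A] [Bialgebra k A] [Ring A'] [Bialgebra k A']
  [AddCommGroup V] [Module k V] [AddCommGroup W] [Module k W]

/-- The module `V^F` obtained by viewing a module `V` through the morphism of quantum groups `F`
with comorphism `φ`: its structure map is `(id ⊗ φ) ∘ ρ`. -/
noncomputable def GroupModule.twist (ρ : GroupModule k A V) (φ : A →ₐc[k] A') :
    GroupModule k A' V where
  coact := (φ : A →ₗ[k] A').lTensor V ∘ₗ ρ.coact
  coassoc := by
    have h : (Coalgebra.comul (R := k) (A := A')) ∘ₗ (φ : A →ₗ[k] A') =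
        TensorProduct.map (φ : A →ₗ[k] A') (φ : A →ₗ[k] A') ∘ₗ Coalgebra.comul :=
      (CoalgHomClass.map_comp_comul φ).symm
    have h' : (Coalgebra.comul (R := k) (A := A')).lTensor V ∘ₗ
        (φ : A →ₗ[k] A').lTensor V ∘ₗ ρ.coact =
        (TensorProduct.map (φ : A →ₗ[k] A') (φ : A →ₗ[k] A')).lTensor V ∘ₗ
          (TensorProduct.assoc k V A A).toLinearMap ∘ₗ ρ.coact.rTensor A ∘ₗ ρ.coact := by
      rw [ρ.coassoc, ← LinearMap.comp_assoc, ← LinearMap.comp_assoc, ← LinearMap.lTensor_comp,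
        ← LinearMap.lTensor_comp, h]
    rw [h']
    refine LinearMap.ext fun v => ?_
    simp only [LinearMap.comp_apply]
    generalize ρ.coact v = x
    induction x with
    | zero => simp
    | add x y hx hy => simp only [map_add, hx, hy]
    | tmul v a =>
      simp only [LinearMap.lTensor_tmul, LinearMap.rTensor_tmul, LinearMap.comp_apply]
      generalize ρ.coact v = x
      induction x with
      | zero => simp
      | add x y hx hy => simp only [map_add, TensorProduct.add_tmul, hx, hy]
      | tmul v b => simp
  counit := by
    have h : (Coalgebra.counit (R := k) (A := A')) ∘ₗ (φ : A →ₗ[k] A') = Coalgebra.counit :=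
      CoalgHomClass.counit_comp φ
    have h' : (Coalgebra.counit (R := k) (A := A')).lTensor V ∘ₗ
        (φ : A →ₗ[k] A').lTensor V ∘ₗ ρ.coact =
        (Coalgebra.counit (R := k) (A := A)).lTensor V ∘ₗ ρ.coact := by
      rw [← LinearMap.comp_assoc, ← LinearMap.lTensor_comp, h]
    rw [h', ρ.counit]

/-- For an algebra `C`, the map `(V ⊗ C) ⊗ (W ⊗ C) → (V ⊗ W) ⊗ C` that multiplies the
coefficients: `(v ⊗ c) ⊗ (w ⊗ d) ↦ (v ⊗ w) ⊗ c d`. -/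
noncomputable def mulCoeff (k V W C : Type*) [Field k] [Ring C] [Algebra k C] [AddCommGroup V]
    [Module k V] [AddCommGroup W] [Module k W] :
    (V ⊗[k] C) ⊗[k] (W ⊗[k] C) →ₗ[k] (V ⊗[k] W) ⊗[k] C :=
  (LinearMap.mul' k C).lTensor (V ⊗[k] W) ∘ₗ
    (TensorProduct.tensorTensorTensorComm k V C W C).toLinearMap

theorem mulCoeff_tmul {C : Type*} [Ring C] [Algebra k C] (v : V) (c : C) (w : W) (d : C) :
    mulCoeff k V W C ((v ⊗ₜ c) ⊗ₜ (w ⊗ₜ d)) = (v ⊗ₜ w) ⊗ₜ (c * d) := rfl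

/-- The tensor product of two modules, with structure map
`v ⊗ w ↦ ∑ v₍₀₎ ⊗ w₍₀₎ ⊗ v₍₁₎ w₍₁₎`. -/
noncomputable def GroupModule.tensor (ρ : GroupModule k A V) (σ : GroupModule k A W) :
    GroupModule k A (V ⊗[k] W) where
  coact := mulCoeff k V W A ∘ₗ TensorProduct.map ρ.coact σ.coact
  coassoc := by
    refine TensorProduct.ext' fun v w => ?_
    have hρ := LinearMap.congr_fun ρ.coassoc v
    have hσ := LinearMap.congr_fun σ.coassoc w
    simp only [LinearMap.comp_apply, LinearEquiv.coe_coe] at hρ hσ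
    have h1 : ∀ (x : V ⊗[k] A) (y : W ⊗[k] A),
        (Coalgebra.comul (R := k) (A := A)).lTensor (V ⊗[k] W) (mulCoeff k V W A (x ⊗ₜ y)) =
        mulCoeff k V W (A ⊗[k] A) ((Coalgebra.comul (R := k) (A := A)).lTensor V x ⊗ₜ
          (Coalgebra.comul (R := k) (A := A)).lTensor W y) := by
      intro x y
      induction x with
      | zero => simp
      | add x x' hx hx' => simp only [map_add, TensorProduct.add_tmul, hx, hx']
      | tmul v a =>
        induction y with
        | zero => simp
        | add y y' hy hy' => simp only [map_add, TensorProduct.tmul_add, hy, hy']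
        | tmul w b => simp only [mulCoeff_tmul, LinearMap.lTensor_tmul, Bialgebra.comul_mul]
    have h2 : ∀ (a b : A) (x : V ⊗[k] A) (y : W ⊗[k] A),
        TensorProduct.assoc k (V ⊗[k] W) A A (mulCoeff k V W A (x ⊗ₜ y) ⊗ₜ (a * b)) =
        mulCoeff k V W (A ⊗[k] A) (TensorProduct.assoc k V A A (x ⊗ₜ a) ⊗ₜ
          TensorProduct.assoc k W A A (y ⊗ₜ b)) := by
      intro a b x y
      induction x with
      | zero => simp
      | add x x' hx hx' => simp only [map_add, TensorProduct.add_tmul, hx, hx']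
      | tmul v c =>
        induction y with
        | zero => simp
        | add y y' hy hy' =>
          simp only [map_add, TensorProduct.tmul_add, TensorProduct.add_tmul, hy, hy']
        | tmul w d => simp [mulCoeff_tmul]
    have h3 : ∀ (x : V ⊗[k] A) (y : W ⊗[k] A),
        TensorProduct.assoc k (V ⊗[k] W) A A
          ((mulCoeff k V W A ∘ₗ TensorProduct.map ρ.coact σ.coact).rTensor A
            (mulCoeff k V W A (x ⊗ₜ y))) =
        mulCoeff k V W (A ⊗[k] A)
          (TensorProduct.assoc k V A A (ρ.coact.rTensor A x) ⊗ₜ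
            TensorProduct.assoc k W A A (σ.coact.rTensor A y)) := by
      intro x y
      induction x with
      | zero => simp
      | add x x' hx hx' => simp only [map_add, TensorProduct.add_tmul, hx, hx']
      | tmul v a =>
        induction y with
        | zero => simp
        | add y y' hy hy' => simp only [map_add, TensorProduct.tmul_add, hy, hy']
        | tmul w b =>
          rw [mulCoeff_tmul, LinearMap.rTensor_tmul, LinearMap.rTensor_tmul,
            LinearMap.rTensor_tmul, LinearMap.comp_apply, TensorProduct.map_tmul, h2]
    simp only [LinearMap.comp_apply, TensorProduct.map_tmul, LinearEquiv.coe_coe]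
    rw [h1, ← hρ, ← hσ, ← h3]
  counit := by
    refine TensorProduct.ext' fun v w => ?_
    have hρ := LinearMap.congr_fun ρ.counit v
    have hσ := LinearMap.congr_fun σ.counit w
    simp only [LinearMap.comp_apply, LinearEquiv.coe_coe, LinearMap.id_apply] at hρ hσ
    have h : ∀ (x : V ⊗[k] A) (y : W ⊗[k] A),
        TensorProduct.rid k (V ⊗[k] W) ((Coalgebra.counit (R := k) (A := A)).lTensor (V ⊗[k] W)
          (mulCoeff k V W A (x ⊗ₜ y))) =
        TensorProduct.rid k V ((Coalgebra.counit (R := k) (A := A)).lTensor V x) ⊗ₜ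
          TensorProduct.rid k W ((Coalgebra.counit (R := k) (A := A)).lTensor W y) := by
      intro x y
      induction x with
      | zero => simp
      | add x x' hx hx' => simp only [map_add, TensorProduct.add_tmul, hx, hx']
      | tmul v a =>
        induction y with
        | zero => simp
        | add y y' hy hy' => simp only [map_add, TensorProduct.tmul_add, hy, hy']
        | tmul w b =>
          simp only [mulCoeff_tmul, LinearMap.lTensor_tmul, TensorProduct.rid_tmul,
            Bialgebra.counit_mul, TensorProduct.smul_tmul_smul]
    simp only [LinearMap.comp_apply, TensorProduct.map_tmul, LinearEquiv.coe_coe,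
      LinearMap.id_apply]
    rw [h, hρ, hσ]

end Modules

/-! ### Centrality of the image of the quantum Frobenius comorphism. -/

section Centre

variable {k : Type*} [Field k] {n : ℕ} {q : k} {ℓ : ℕ}

/-! The two structure maps being compared have the same tensor legs and differ only in the order of
the coefficients: one has `a * φ b`, the other `φ b * a`, where `a` comes from `M`, `b` from `N`,
and `φ` is the comorphism of the quantum Frobenius. So the flip is a comodule map as soon as `φ`
takes central values, and both assertions reduce to that centrality. The substance lies in producing
`φ` at all, as a map into the centre defined on the localised algebra `k[GL_n]`.

The powers `c_ij ^ ℓ` are central. Two coordinate functions either commute, or `q`-commute, or are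
related by the `cross` relation. In the last case write `a = c_ir`, `b = c_is`, `c = c_jr`, `d =
c_js` with `i < j` and `r < s`. Moving `d` past `a ^ m` gives the error `(q ^ m - 1) • (a ^ (m - 1)
* (b * c))`, and moving `a` past `d ^ m` gives a similar one. In every case `q ^ ℓ = 1` removes the
obstruction (`IsQuantumMatrix.pow_commute`). An element commuting with all `c_ij` commutes with the
quantum determinant, hence with its inverse, hence with everything
(`QuantumGL.commute_of_commute_coord`).

The determinant `z` of the matrix of these central powers is invertible in the centre
(`IsQuantumMatrix.isUnit_det_pow`), which is what lets the map extend over the localisation at `det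
(y_ij)`. If `z` had no inverse, it would vanish in some simple quotient, whose centre is a field. A
singular matrix over that field gives a nonzero `v` with `∑ i, v i • c_ij ^ ℓ = 0` for all `j`.
After passing to an algebraic closure, write `v i = a i ^ ℓ` and put `w j = ∑ i, a i • c_ij`.
Entries of one column `q`-commute, and the Gaussian binomial coefficients strictly between the ends
vanish at a primitive `ℓ`-th root of unity, so `w j ^ ℓ = ∑ i, v i • c_ij ^ ℓ = 0`. The `w j`
commute with each other, so being nilpotent they are all killed on the left by a single nonzero `P`.
But the quantum determinant is alternating in its rows: replacing row `i` by `w` and expanding along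
it gives `∑ j, w j * s j = a i • d_q`, a unit when `a i ≠ 0` (`IsQuantumMatrix.exists_sum_mul_eq`).
Multiplying by `P` forces `P = 0`, a contradiction.

The same binomial identity makes `φ` compatible with comultiplication, because the summands `c_ir ⊗
c_rj` of the comultiplication of `c_ij` also `q`-commute. What remains is to read off centrality and
transport it through the tensor product (`mulCoeff_lTensor_comm`). -/

theorem quantumFrobenius_mem_center (hq : IsPrimitiveRoot q ℓ) (hℓ : 0 < ℓ)
    (f : ClassicalGL k n) :
    quantumFrobenius n hq hℓ f ∈ Subalgebra.center k (QuantumGL k n q) :=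
  -- By construction the comorphism is a map into the centre followed by the inclusion. Its value at
  -- `f` is therefore the coercion of this central element, and the membership proof is the second
  -- component. No extension from generators is needed here, since `ClassicalGL.lift` has already
  -- dealt with the inverse of the determinant.
  (ClassicalGL.lift (frobeniusMatrix n hq)
    (QuantumGL.coord_isQuantumMatrix.isUnit_det_pow QuantumGL.isUnit_qdet_coord hq hℓ _
      fun _ _ => rfl) f).2

end Centre

/-! ### The flip for a twist with central coefficients. -/

section Flip

variable {k A A' V W : Type*} [Field k] [Ring A] [Bialgebra k A] [Ring A'] [Bialgebra k A']
  [AddCommGroup V] [Module k V] [AddCommGroup W] [Module k W]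

/-- Both sides are bilinear in `x` and `y`, and on pure tensors they differ only by exchanging a
coefficient `a` with a central one `φ b`. The elements `x` and `y` stand for the values of the two
structure maps; leaving them arbitrary is what makes induction on tensors available. Keeping `y`
over `A'`, before `φ` is applied, ensures that each coefficient met in the induction is visibly of
the form `φ b`. -/
theorem mulCoeff_lTensor_comm (φ : A' →ₗ[k] A) (hφ : ∀ f, φ f ∈ Subalgebra.center k A)
    (x : V ⊗[k] A) (y : W ⊗[k] A') :
    mulCoeff k W V A (φ.lTensor W y ⊗ₜ x) =
      (TensorProduct.comm k V W).toLinearMap.rTensor A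
        (mulCoeff k V W A (x ⊗ₜ φ.lTensor W y)) := by
  induction x with
  | zero => simp
  | add x x' hx hx' => simp only [map_add, TensorProduct.add_tmul, TensorProduct.tmul_add, hx, hx']
  | tmul v a =>
    induction y with
    | zero => simp
    | add y y' hy hy' =>
      simp only [map_add, TensorProduct.add_tmul, TensorProduct.tmul_add, hy, hy']
    | tmul w b =>
      -- The two sides become `(w ⊗ v) ⊗ (φ b * a)` and `(w ⊗ v) ⊗ (a * φ b)`; centrality of `φ b`
      -- closes the gap.
      simp only [LinearMap.lTensor_tmul, mulCoeff_tmul, LinearMap.rTensor_tmul,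
        LinearEquiv.coe_coe, TensorProduct.comm_tmul, Subalgebra.mem_center_iff.1 (hφ b) a]

/-- The flip is an isomorphism between the two tensor products of a module with a module twisted
by a comorphism that takes central values. -/
noncomputable def GroupModule.flipIso (ρ : GroupModule k A V) (σ : GroupModule k A' W)
    (φ : A' →ₐc[k] A) (hφ : ∀ f, φ f ∈ Subalgebra.center k A) :
    GroupModule.Iso (ρ.tensor (σ.twist φ)) ((σ.twist φ).tensor ρ) where
  toLinearEquiv := TensorProduct.comm k V W
  -- On `v ⊗ w` the structure map of the twist contributes `φ` applied to the coefficients of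
  -- `σ.coact w`, so the required identity is definitionally the preceding lemma at `x = ρ.coact v`,
  -- `y = σ.coact w`.
  map_coact := TensorProduct.ext' fun v w =>
    mulCoeff_lTensor_comm (φ : A' →ₗ[k] A) hφ (ρ.coact v) (σ.coact w)

end Flip

/-! ### The two assertions for the quantum general linear group. -/

theorem lemma3p1 {k : Type*} [Field k] (n : ℕ) {q : k} {ℓ : ℕ} (hq : IsPrimitiveRoot q ℓ)
    (hℓ : 0 < ℓ) {M N : Type*} [AddCommGroup M] [Module k M] [FiniteDimensional k M]
    [AddCommGroup N] [Module k N] (ρ : GroupModule k (QuantumGL k n q) M)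
    (σ : GroupModule k (ClassicalGL k n) N) :
    (∀ f : ClassicalGL k n,
      quantumFrobenius n hq hℓ f ∈ Subalgebra.center k (QuantumGL k n q)) ∧
    ∃ φ : GroupModule.Iso (ρ.tensor (σ.twist (quantumFrobenius n hq hℓ)))
        ((σ.twist (quantumFrobenius n hq hℓ)).tensor ρ),
      ∀ (x : M) (y : N), φ.toLinearEquiv (x ⊗ₜ[k] y) = y ⊗ₜ[k] x := by
  -- Centrality serves twice: as the first assertion and as the hypothesis of `GroupModule.flipIso`.
  -- The underlying linear map of that isomorphism is `TensorProduct.comm`, so its formula on pure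
  -- tensors holds by `rfl`.
  exact ⟨quantumFrobenius_mem_center hq hℓ,
    ρ.flipIso σ _ (quantumFrobenius_mem_center hq hℓ), fun _ _ => rfl⟩
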